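/- For a positive even integer $n$, let $V_n=\{1,\dots,n\}$, let $W_n=V_n\times\{1,2,3\}$, and let $\mathcal F_3(n)$ be the set of all $(3n-1)!!$ perfect matchings ("pairings") of the set $W_n$. For $F\in\mathcal F_3(n)$ let $\pi(F)$ be the 3-regular multigraph on $V_n$ (loops and multiple edges allowed) obtained from $F$ by ignoring the second coordinates, so that every pair $\{(u,i),(v,j)\}\in F$ gives one edge $uv$. Let $\mathcal G'_{16}(n)$ be the set of those $F\in\mathcal F_3(n)$ for which $\pi(F)$ is a simple cubic graph of girth at least $16$, and let $\alpha$ denote the independence number. Then for every $\varepsilon>0$ there is an integer $N>0$ such that for every even $n>N$, $$\bigl|\{F\in\mathcal G'_{16}(n) : \alpha(\pi(F))>0.454\,n\}\bigr|<\varepsilon\,(3n-1)!!.$$ -/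

import Mathlib

namespace ConfigModel

/-- The points `W_n = V_n × [3]`, where the vertex set `V_n` is `Fin n`. -/
abbrev Points (n : ℕ) : Type := Fin n × Fin 3

/-- `ℱ₃(n)`: a pairing is a perfect matching of the points, that is, a perfect matching of the
complete graph on `Points n`. -/
def Pairing (n : ℕ) : Type :=
  {M : (⊤ : SimpleGraph (Points n)).Subgraph // M.IsPerfectMatching}

/-- The projection `π(F)`: the multigraph on the vertices `Fin n` with one edge for every
pair in `F`, obtained by ignoring the second coordinate. Loops and multiple edges may occur. -/
noncomputable def Pairing.proj {n : ℕ} (F : Pairing n) : Graph (Fin n) (Sym2 (Points n)) :=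
  (Graph.ofSimpleGraph F.1.spanningCoe).map Prod.fst

/-- The simple graph on `Fin n` in which two distinct vertices are adjacent when some edge of
the multigraph `π(F)` joins them. If `π(F)` is simple, this is `π(F)` itself. -/
def Pairing.graph {n : ℕ} (F : Pairing n) : SimpleGraph (Fin n) where
  Adj u v := u ≠ v ∧ F.proj.Adj u v
  symm := ⟨fun _ _ h => ⟨h.1.symm, h.2.symm⟩⟩

/-- `𝒢_g(n)`: the cubic simple graphs with vertex set `Fin n` and girth at least `g`. -/
def cubicGraphs (g n : ℕ) : Set (SimpleGraph (Fin n)) :=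
  {G | (∀ v, (G.neighborSet v).ncard = 3) ∧ (g : ℕ∞) ≤ G.egirth}

/-- `𝒢'_g(n)`: the pairings whose projection is a simple graph (no loops and no multiple
edges) belonging to `𝒢_g(n)`. -/
def girthPairings (g n : ℕ) : Set (Pairing n) :=
  {F | F.proj.Simple ∧ F.graph ∈ cubicGraphs g n}

/-- The independence number `α(π(F))`: the largest size of a set of vertices
no two of which are joined by an edge of `π(F)`. -/
noncomputable def Pairing.indepNum {n : ℕ} (F : Pairing n) : ℕ := F.graph.indepNum

/-- There are only finitely many pairings, so cardinalities of sets of pairings are genuine. -/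
instance (n : ℕ) : Finite (Pairing n) :=
  inferInstanceAs (Finite {M : (⊤ : SimpleGraph (Points n)).Subgraph // M.IsPerfectMatching})

end ConfigModel

/-! This is a first-moment bound on `3 ^ α`, obtained by interpolation. Place the `2m = 3n` points
in uniformly random order. Pairing consecutive positions gives the configuration model. Consider
hybrid systems in which the first `2j` positions carry `j` edges and the last `k` carry fields, each
active with probability 1/2 and charging 1 for selecting its vertex; the positions in between are
free. `total` is the unnormalised mean of `3 ^ optimum`.

Call a vertex frozen if it lies in every optimal set, and let `r` be the weighted probability that a
free position is frozen. A new edge lowers the optimum whenever both ends are frozen, so it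
multiplies the total by at most about `1 - 2r²/3`, the square coming from exchangeability and a
second-moment bound. A new field multiplies it by at least `1 - r/3`. Since `(5/6)(1 - 2r²/3) ≤ (1 -
r/3)²`, one edge can be traded for two fields at a cost of 6/5 (`total_edge_mul_le`).
`sum_window_le` and `interpolate_log` iterate this over all edges with sublinear boundary loss and a
small linear loss.

With fields only, vertices decouple, each giving the mean `(7 + 3)/8 = 5/4` (`total_all_fields_le`).
Hence the mean of `3 ^ α` is at most roughly `((5/4)(6/5)^(3/2))^n`, whose base is below `3 ^ 0.454`
(`decayRate_pos`). Markov's inequality, through `ncard_mul_le_total`, finishes the proof. -/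

set_option linter.unusedSectionVars false

namespace ConfigModel

open Finset

/-! ### Frozen elements and the response of a maximum to one constraint. -/

section Maximisers
variable {V : Type*}

/-- Every maximiser of `e` over the family `A` contains `x`. -/
def Frozen (A : Finset (Finset V)) (e : Finset V → ℕ) (x : V) : Prop :=
  ∀ S ∈ A, e S = A.sup e → x ∈ S

open Classical in
/-- The indicator of `Frozen`. -/
noncomputable def frozenInd (A : Finset (Finset V)) (e : Finset V → ℕ) (x : V) : ℝ :=
  if Frozen A e x then 1 else 0

theorem frozenInd_nonneg (A : Finset (Finset V)) (e : Finset V → ℕ) (x : V) :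
    0 ≤ frozenInd A e x := by
  unfold frozenInd; split_ifs <;> norm_num

theorem frozenInd_le_one (A : Finset (Finset V)) (e : Finset V → ℕ) (x : V) :
    frozenInd A e x ≤ 1 := by
  unfold frozenInd; split_ifs <;> norm_num

theorem frozenInd_mul_self (A : Finset (Finset V)) (e : Finset V → ℕ) (x : V) :
    frozenInd A e x * frozenInd A e x = frozenInd A e x := by
  unfold frozenInd; split_ifs <;> norm_num

/-- A unit charge at `x` costs at most one, and nothing if some maximiser avoids `x`. With base 3 a
drop by one is the factor `1/3 = 1 - 2/3`. -/
theorem three_pow_sup_penalty [DecidableEq V] {A : Finset (Finset V)} (hA : A.Nonempty)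
    {e e' : Finset V → ℕ}
    {x : V} (he : ∀ S, e S ≤ e' S + if x ∈ S then 1 else 0) :
    (3 : ℝ) ^ A.sup e * (1 - 2 / 3 * frozenInd A e x) ≤ 3 ^ A.sup e' := by
  unfold frozenInd
  split_ifs with hf
  · obtain ⟨S, hS, hm⟩ := Finset.exists_mem_eq_sup A hA e
    have h1 : A.sup e ≤ A.sup e' + 1 := by
      have := he S
      have := Finset.le_sup (f := e') hS
      split_ifs at * <;> omega
    calc (3 : ℝ) ^ A.sup e * (1 - 2 / 3 * 1) ≤ 3 ^ (A.sup e' + 1) * (1 - 2 / 3 * 1) := by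
          gcongr; norm_num
      _ = _ := by rw [pow_succ]; ring
  · simp only [Frozen, not_forall] at hf
    obtain ⟨S, hS, hm, hx⟩ := hf
    have h1 : A.sup e ≤ A.sup e' := by
      have := he S
      have := Finset.le_sup (f := e') hS
      simp only [hx, if_false] at *
      omega
    simpa using pow_le_pow_right₀ (by norm_num : (1 : ℝ) ≤ 3) h1

/-- If `x` and `y` are both frozen, every old maximiser violates the new constraint, so the integer
maximum drops by at least one. -/
theorem three_pow_sup_exclude {A A' : Finset (Finset V)} (hA : A'.Nonempty) (hsub : A' ⊆ A)
    {e : Finset V → ℕ} {x y : V} (hxy : ∀ S ∈ A', ¬ (x ∈ S ∧ y ∈ S)) :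
    (3 : ℝ) ^ A'.sup e ≤ 3 ^ A.sup e * (1 - 2 / 3 * (frozenInd A e x * frozenInd A e y)) := by
  have hle : A'.sup e ≤ A.sup e := Finset.sup_mono hsub
  have hle' := pow_le_pow_right₀ (by norm_num : (1 : ℝ) ≤ 3) hle
  unfold frozenInd
  split_ifs with hx hy
  · obtain ⟨S, hS, hm⟩ := Finset.exists_mem_eq_sup A' hA e
    have h1 : A'.sup e + 1 ≤ A.sup e := by
      rcases hle.lt_or_eq with h | h
      · exact h
      · exact (hxy S hS ⟨hx S (hsub hS) (by omega), hy S (hsub hS) (by omega)⟩).elim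
    have := pow_le_pow_right₀ (by norm_num : (1 : ℝ) ≤ 3) h1
    rw [pow_succ] at this
    linarith
  all_goals simpa using hle'

end Maximisers

/-! ### Hybrid systems with edges and fields. -/

section State
variable {V : Type*} [Fintype V] [DecidableEq V] {N : ℕ}

/-- `S` contains no edge `{x p, x (p + 1)}` among the first `j` pairs of consecutive positions. -/
def IsIndep (x : Fin N → V) (j : ℕ) (S : Finset V) : Prop :=
  ∀ p q : Fin N, (q : ℕ) = p + 1 → Even (p : ℕ) → (q : ℕ) < 2 * j → ¬ (x p ∈ S ∧ x q ∈ S)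

open Classical in
/-- The sets satisfying `IsIndep`. -/
noncomputable def indepFamily (x : Fin N → V) (j : ℕ) : Finset (Finset V) := {S | IsIndep x j S}

/-- The number of active positions, among the last `k`, whose label is in `S`. -/
def penalty (x : Fin N → V) (h : Fin N → Bool) (k : ℕ) (S : Finset V) : ℕ :=
  #{p : Fin N | N ≤ p + k ∧ h p = true ∧ x p ∈ S}

/-- Size minus penalty. -/
def value (x : Fin N → V) (h : Fin N → Bool) (k : ℕ) (S : Finset V) : ℕ := #S - penalty x h k S

/-- The largest value of an independent set. -/
noncomputable def optimum (x : Fin N → V) (h : Fin N → Bool) (j k : ℕ) : ℕ :=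
  (indepFamily x j).sup (value x h k)

theorem mem_indepFamily {x : Fin N → V} {j : ℕ} {S : Finset V} :
    S ∈ indepFamily x j ↔ IsIndep x j S := by
  simp [indepFamily]

theorem indepFamily_nonempty (x : Fin N → V) (j : ℕ) : (indepFamily x j).Nonempty :=
  ⟨∅, mem_indepFamily.2 fun _ _ _ _ _ => by simp⟩

theorem indepFamily_succ_subset (x : Fin N → V) (j : ℕ) :
    indepFamily x (j + 1) ⊆ indepFamily x j := fun S hS => by
  rw [mem_indepFamily] at *
  exact fun p q h1 h2 h3 => hS p q h1 h2 (by omega)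

/-- The indicator of being contained in all optimal sets. -/
noncomputable def frz (x : Fin N → V) (h : Fin N → Bool) (j k : ℕ) (p : Fin N) : ℝ :=
  frozenInd (indepFamily x j) (value x h k) (x p)

theorem optimum_edge (x : Fin N → V) (h : Fin N → Bool) (j k : ℕ) {p q : Fin N}
    (hp : (p : ℕ) = 2 * j) (hq : (q : ℕ) = 2 * j + 1) :
    (3 : ℝ) ^ optimum x h (j + 1) k ≤
      3 ^ optimum x h j k * (1 - 2 / 3 * (frz x h j k p * frz x h j k q)) := by
  refine three_pow_sup_exclude (indepFamily_nonempty _ _) (indepFamily_succ_subset x j) ?_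
  intro S hS
  rw [mem_indepFamily] at hS
  exact hS p q (by omega) (by rw [hp]; exact even_two_mul j) (by omega)

theorem penalty_succ (x : Fin N → V) (h : Fin N → Bool) (k : ℕ) (S : Finset V) {p : Fin N}
    (hp : (p : ℕ) + k + 1 = N) :
    penalty x h (k + 1) S = penalty x h k S + if h p = true ∧ x p ∈ S then 1 else 0 := by
  unfold penalty
  rw [Finset.filter_congr (q := fun r : Fin N => (N ≤ r + k ∧ h r = true ∧ x r ∈ S) ∨
    (r = p ∧ h p = true ∧ x p ∈ S)), Finset.filter_or, Finset.card_union_of_disjoint]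
  · congr 1
    split_ifs with hh
    · rw [Finset.card_eq_one]
      exact ⟨p, by ext r; simp [hh]⟩
    · simp [hh]
  · rw [Finset.disjoint_filter]
    rintro r - ⟨h1, -⟩ ⟨rfl, -⟩
    omega
  · intro r _
    constructor
    · rintro ⟨h1, h2, h3⟩
      by_cases hr : r = p
      · subst hr; exact Or.inr ⟨rfl, h2, h3⟩
      · have : (r : ℕ) ≠ p := fun h => hr (Fin.ext h)
        exact Or.inl ⟨by omega, h2, h3⟩
    · rintro (⟨h1, h2⟩ | ⟨rfl, h2⟩)
      · exact ⟨by omega, h2⟩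
      · exact ⟨by omega, h2⟩

theorem optimum_field (x : Fin N → V) (h : Fin N → Bool) (j k : ℕ) {p : Fin N}
    (hp : (p : ℕ) + k + 1 = N) :
    (3 : ℝ) ^ optimum x h j k * (1 - 2 / 3 * ((if h p = true then 1 else 0) * frz x h j k p)) ≤
      3 ^ optimum x h j (k + 1) := by
  by_cases hh : h p = true
  · simp only [hh, if_true, one_mul]
    refine three_pow_sup_penalty (indepFamily_nonempty _ _) fun S => ?_
    simp only [value, penalty_succ x h k S hp, hh, true_and]
    omega
  · have : value x h (k + 1) = value x h k := by
      funext S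
      simp [value, penalty_succ x h k S hp, hh]
    simp [optimum, this, hh]

theorem optimum_field_le (x : Fin N → V) (h : Fin N → Bool) (j k : ℕ) {p : Fin N}
    (hp : (p : ℕ) + k + 1 = N) : optimum x h j (k + 1) ≤ optimum x h j k := by
  refine Finset.sup_mono_fun fun S _ => ?_
  simp only [value, penalty_succ x h k S hp]
  omega

end State

/-! ### Symmetry under permuting free positions. -/

section Invariance
variable {V : Type*} [Fintype V] [DecidableEq V] {N : ℕ}

/-- `τ` moves only positions carrying neither an edge nor a field. -/
def FixesUsed (τ : Equiv.Perm (Fin N)) (j k : ℕ) : Prop :=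
  ∀ p : Fin N, ((p : ℕ) < 2 * j ∨ N ≤ p + k) → τ p = p

theorem FixesUsed.indepFamily_comp {τ : Equiv.Perm (Fin N)} {j k : ℕ} (hτ : FixesUsed τ j k)
    (x : Fin N → V) : indepFamily (x ∘ τ) j = indepFamily x j := by
  ext S
  simp only [mem_indepFamily, IsIndep]
  refine forall_congr' fun p => forall_congr' fun q => ?_
  refine imp_congr_right fun h1 => imp_congr_right fun _ => imp_congr_right fun h3 => ?_
  simp [hτ p (Or.inl (by omega)), hτ q (Or.inl h3)]

theorem FixesUsed.value_comp {τ : Equiv.Perm (Fin N)} {j k : ℕ} (hτ : FixesUsed τ j k)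
    (x : Fin N → V) (h : Fin N → Bool) : value (x ∘ τ) h k = value x h k := by
  funext S
  unfold value penalty
  congr 2
  refine Finset.filter_congr fun p _ => and_congr_right fun h1 => ?_
  simp [hτ p (Or.inr h1)]

theorem FixesUsed.optimum_comp {τ : Equiv.Perm (Fin N)} {j k : ℕ} (hτ : FixesUsed τ j k)
    (x : Fin N → V) (h : Fin N → Bool) : optimum (x ∘ τ) h j k = optimum x h j k := by
  rw [optimum, optimum, hτ.indepFamily_comp, hτ.value_comp]

theorem FixesUsed.frz_comp {τ : Equiv.Perm (Fin N)} {j k : ℕ} (hτ : FixesUsed τ j k)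
    (x : Fin N → V) (h : Fin N → Bool) (p : Fin N) :
    frz (x ∘ τ) h j k p = frz x h j k (τ p) := by
  rw [frz, frz, hτ.indepFamily_comp, hτ.value_comp, Function.comp_apply]

theorem value_update (x : Fin N → V) (h : Fin N → Bool) {k : ℕ} {p : Fin N} (hp : (p : ℕ) + k < N)
    (b : Bool) : value x (Function.update h p b) k = value x h k := by
  funext S
  unfold value penalty
  congr 2
  refine Finset.filter_congr fun q _ => and_congr_right fun h1 => ?_
  have : q ≠ p := by rintro rfl; omega
  simp [Function.update_of_ne this]

/-- The positions carrying neither an edge nor a field. -/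
def freePos (N j k : ℕ) : Finset (Fin N) := {p | 2 * j ≤ p ∧ (p : ℕ) + k < N}

theorem mem_freePos {j k : ℕ} {p : Fin N} : p ∈ freePos N j k ↔ 2 * j ≤ p ∧ (p : ℕ) + k < N := by
  simp [freePos]

theorem card_freePos (N j k : ℕ) : #(freePos N j k) = N - k - 2 * j := by
  rw [← Nat.card_Ico, ← Finset.card_map Fin.valEmbedding]
  congr 1
  ext a
  simp only [mem_map, mem_freePos, Fin.valEmbedding_apply, mem_Ico]
  constructor
  · rintro ⟨p, h, rfl⟩; omega
  · intro h; exact ⟨⟨a, by omega⟩, by simp; omega, rfl⟩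

theorem fixesUsed_swap {j k : ℕ} {p q : Fin N} (hp : p ∈ freePos N j k) (hq : q ∈ freePos N j k) :
    FixesUsed (Equiv.swap p q) j k := by
  intro r hr
  rw [mem_freePos] at hp hq
  apply Equiv.swap_apply_of_ne_of_ne <;> rintro rfl <;> omega

theorem FixesUsed.trans {σ τ : Equiv.Perm (Fin N)} {j k : ℕ} (hσ : FixesUsed σ j k)
    (hτ : FixesUsed τ j k) : FixesUsed (σ.trans τ) j k := fun p hp => by
  rw [Equiv.trans_apply, hσ p hp, hτ p hp]

theorem FixesUsed.mem_freePos {σ : Equiv.Perm (Fin N)} {j k : ℕ} (hσ : FixesUsed σ j k)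
    {p : Fin N} (hp : p ∈ freePos N j k) : σ p ∈ freePos N j k := by
  by_contra hc
  have h1 : σ (σ p) = σ p := hσ _ (by rw [ConfigModel.mem_freePos] at hc; omega)
  rw [σ.injective h1] at hc
  exact hc hp

theorem exists_fixesUsed_map_pair {j k : ℕ} {a b p q : Fin N} (ha : a ∈ freePos N j k)
    (hb : b ∈ freePos N j k) (hp : p ∈ freePos N j k) (hq : q ∈ freePos N j k)
    (hab : a ≠ b) (hpq : p ≠ q) :
    ∃ τ : Equiv.Perm (Fin N), FixesUsed τ j k ∧ τ a = p ∧ τ b = q := by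
  have h1 := fixesUsed_swap ha hp
  have hs : Equiv.swap a p b ≠ p := fun h =>
    hab ((Equiv.swap a p).injective (by rw [h, Equiv.swap_apply_left]))
  refine ⟨(Equiv.swap a p).trans (Equiv.swap (Equiv.swap a p b) q),
    h1.trans (fixesUsed_swap (h1.mem_freePos hb) hq), ?_, ?_⟩
  · rw [Equiv.trans_apply, Equiv.swap_apply_left, Equiv.swap_apply_of_ne_of_ne hs.symm hpq]
  · rw [Equiv.trans_apply, Equiv.swap_apply_left]

end Invariance

/-! ### Averages over arrangements and fields, and the one-edge-for-two-fields inequality. -/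

section Average
variable {V P : Type*} [Fintype V] [DecidableEq V] [Fintype P] [DecidableEq P] {N : ℕ}

/-- The sum of `3 ^ optimum` over all arrangements of the points and all fields. -/
noncomputable def total (N : ℕ) (v : P → V) (j k : ℕ) : ℝ :=
  ∑ π : Fin N ≃ P, ∑ h : Fin N → Bool, (3 : ℝ) ^ optimum (v ∘ π) h j k

theorem sum_comp_perm (τ : Equiv.Perm (Fin N)) (v : P → V) (F : (Fin N → V) → ℝ) :
    ∑ π : Fin N ≃ P, F (v ∘ π) = ∑ π : Fin N ≃ P, F ((v ∘ π) ∘ τ) :=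
  (Fintype.sum_equiv
    (⟨fun π => τ.trans π, fun π => τ.symm.trans π, fun π => by ext; simp, fun π => by ext; simp⟩ :
      (Fin N ≃ P) ≃ (Fin N ≃ P)) _ _ fun _ => rfl).symm

/-- The weighted sum of the frozen indicator at position `p`. -/
noncomputable def total₁ (v : P → V) (j k : ℕ) (p : Fin N) : ℝ :=
  ∑ π : Fin N ≃ P, ∑ h : Fin N → Bool, (3 : ℝ) ^ optimum (v ∘ π) h j k * frz (v ∘ π) h j k p

/-- The weighted sum of the product of the frozen indicators at positions `p` and `q`. -/
noncomputable def total₂ (v : P → V) (j k : ℕ) (p q : Fin N) : ℝ :=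
  ∑ π : Fin N ≃ P, ∑ h : Fin N → Bool,
    (3 : ℝ) ^ optimum (v ∘ π) h j k * (frz (v ∘ π) h j k p * frz (v ∘ π) h j k q)

theorem total₁_eq (v : P → V) {j k : ℕ} {p q : Fin N} (hp : p ∈ freePos N j k)
    (hq : q ∈ freePos N j k) : total₁ v j k p = total₁ v j k q := by
  have hτ := fixesUsed_swap hp hq
  unfold total₁
  rw [sum_comp_perm (Equiv.swap p q) v
    fun x => ∑ h : Fin N → Bool, (3 : ℝ) ^ optimum x h j k * frz x h j k p]
  simp [hτ.optimum_comp, hτ.frz_comp]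

/-- Free positions are exchangeable: a permutation of them preserves the law of the arrangement and
the optimum, and it can carry any ordered pair of distinct free positions to any other. -/
theorem total₂_eq (v : P → V) {j k : ℕ} {a b p q : Fin N} (ha : a ∈ freePos N j k)
    (hb : b ∈ freePos N j k) (hp : p ∈ freePos N j k) (hq : q ∈ freePos N j k)
    (hab : a ≠ b) (hpq : p ≠ q) : total₂ v j k a b = total₂ v j k p q := by
  obtain ⟨τ, hτ, rfl, rfl⟩ := exists_fixesUsed_map_pair ha hb hp hq hab hpq
  unfold total₂
  rw [sum_comp_perm τ v fun x => ∑ h : Fin N → Bool,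
    (3 : ℝ) ^ optimum x h j k * (frz x h j k a * frz x h j k b)]
  simp [hτ.optimum_comp, hτ.frz_comp]

theorem frz_nonneg (x : Fin N → V) (h : Fin N → Bool) (j k : ℕ) (p : Fin N) :
    0 ≤ frz x h j k p := frozenInd_nonneg _ _ _

theorem frz_le_one (x : Fin N → V) (h : Fin N → Bool) (j k : ℕ) (p : Fin N) :
    frz x h j k p ≤ 1 := frozenInd_le_one _ _ _

theorem total₁_nonneg (v : P → V) (j k : ℕ) (p : Fin N) : 0 ≤ total₁ v j k p :=
  sum_nonneg fun _ _ => sum_nonneg fun _ _ => mul_nonneg (by positivity) (frz_nonneg _ _ _ _ _)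

theorem total₁_le (v : P → V) (j k : ℕ) (p : Fin N) : total₁ v j k p ≤ total N v j k :=
  sum_le_sum fun _ _ => sum_le_sum fun _ _ =>
    mul_le_of_le_one_right (by positivity) (frz_le_one _ _ _ _ _)

/-- The second moment bound for the frozen fraction, without replacement. -/
theorem total₂_ge (v : P → V) {j k : ℕ} {p q : Fin N} (hp : p ∈ freePos N j k)
    (hq : q ∈ freePos N j k) (hpq : p ≠ q) (r : ℝ) (hr : total₁ v j k p = r * total N v j k) :
    (#(freePos N j k) : ℝ) * (r ^ 2 * #(freePos N j k) - r) * total N v j k ≤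
      (#(freePos N j k) : ℝ) * (#(freePos N j k) - 1) * total₂ v j k p q := by
  set E := freePos N j k with hE
  set M : ℝ := (#E : ℝ) with hM
  have hfirst : M * total₁ v j k p = ∑ a ∈ E, total₁ v j k a := by
    rw [Finset.sum_congr rfl fun a ha => total₁_eq v ha hp, sum_const, nsmul_eq_mul]
  have hsecond : M * (M - 1) * total₂ v j k p q = ∑ a ∈ E, ∑ b ∈ E.erase a, total₂ v j k a b := by
    have h1 : ∀ a ∈ E, ∑ b ∈ E.erase a, total₂ v j k a b = (M - 1) * total₂ v j k p q := by
      intro a ha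
      rw [Finset.sum_congr rfl fun b hb => total₂_eq v ha (mem_of_mem_erase hb) hp hq
        (ne_of_mem_erase hb).symm hpq]
      rw [sum_const, card_erase_of_mem ha, nsmul_eq_mul,
        Nat.cast_sub (Finset.card_pos.2 ⟨a, ha⟩), Nat.cast_one]
    rw [Finset.sum_congr rfl h1]; simp [hM]; ring
  have hS : ∀ (π : Fin N ≃ P) (h : Fin N → Bool),
      (3 : ℝ) ^ optimum (v ∘ π) h j k * ((2 * r * M - 1) * (∑ a ∈ E, frz (v ∘ π) h j k a)
        - r ^ 2 * M ^ 2) ≤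
      ∑ a ∈ E, ∑ b ∈ E.erase a,
        (3 : ℝ) ^ optimum (v ∘ π) h j k * (frz (v ∘ π) h j k a * frz (v ∘ π) h j k b) := by
    intro π h
    set f := frz (v ∘ π) h j k
    have h2 : ∑ a ∈ E, ∑ b ∈ E.erase a, f a * f b = (∑ a ∈ E, f a) ^ 2 - ∑ a ∈ E, f a := by
      rw [sq, Finset.sum_mul_sum, ← Finset.sum_sub_distrib]
      refine Finset.sum_congr rfl fun a ha => ?_
      rw [← Finset.add_sum_erase E _ ha, show f a * f a = f a from frozenInd_mul_self _ _ _]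
      ring
    simp only [← Finset.mul_sum] at h2 ⊢
    rw [h2]
    refine mul_le_mul_of_nonneg_left ?_ (by positivity)
    -- The square of the frozen count is bounded below by its tangent at the mean `r * M`; being
    -- linear in the count, the tangent can be averaged.
    nlinarith [sq_nonneg ((∑ a ∈ E, f a) - r * M)]
  have hsum := Finset.sum_le_sum fun π (_ : π ∈ (univ : Finset (Fin N ≃ P))) =>
    Finset.sum_le_sum fun h (_ : h ∈ (univ : Finset (Fin N → Bool))) => hS π h
  have hR : ∑ π : Fin N ≃ P, ∑ h : Fin N → Bool, ∑ a ∈ E, ∑ b ∈ E.erase a,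
      (3 : ℝ) ^ optimum (v ∘ π) h j k * (frz (v ∘ π) h j k a * frz (v ∘ π) h j k b) =
      M * (M - 1) * total₂ v j k p q := by
    rw [hsecond]
    simp only [total₂, Finset.sum_comm (s := (univ : Finset (Fin N → Bool))) (t := E),
      Finset.sum_comm (s := (univ : Finset (Fin N ≃ P))) (t := E)]
    refine Finset.sum_congr rfl fun a _ => ?_
    simp only [Finset.sum_comm (s := (univ : Finset (Fin N → Bool))) (t := E.erase a),
      Finset.sum_comm (s := (univ : Finset (Fin N ≃ P))) (t := E.erase a)]
  have hL : ∑ π : Fin N ≃ P, ∑ h : Fin N → Bool,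
      (3 : ℝ) ^ optimum (v ∘ π) h j k * ((2 * r * M - 1) * (∑ a ∈ E, frz (v ∘ π) h j k a)
        - r ^ 2 * M ^ 2) =
      (2 * r * M - 1) * (M * total₁ v j k p) - r ^ 2 * M ^ 2 * total N v j k := by
    rw [hfirst]
    simp only [total₁, total, Finset.sum_comm (s := E), mul_sub, Finset.sum_sub_distrib,
      Finset.mul_sum]
    congr 1
    · refine Finset.sum_congr rfl fun π _ => ?_
      exact Finset.sum_congr rfl fun h _ => Finset.sum_congr rfl fun a _ => by ring
    · exact Finset.sum_congr rfl fun π _ => Finset.sum_congr rfl fun h _ => by ring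
  rw [hR, hL, hr] at hsum
  linarith

theorem total_edge (v : P → V) {j k : ℕ} {p q : Fin N} (hp : (p : ℕ) = 2 * j)
    (hq : (q : ℕ) = 2 * j + 1) :
    total N v (j + 1) k ≤ total N v j k - 2 / 3 * total₂ v j k p q := by
  simp only [total, total₂, Finset.mul_sum, ← Finset.sum_sub_distrib]
  refine Finset.sum_le_sum fun π _ => Finset.sum_le_sum fun h _ => ?_
  have := optimum_edge (v ∘ π) h j k hp hq
  linarith

/-- Flipping the bit at `p` swaps active and inactive fields without changing `F`, so exactly half
the weight is active. This is why a field costs `r/3`, not `2r/3`. -/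
theorem two_mul_sum_ite_update {p : Fin N} (F : (Fin N → Bool) → ℝ)
    (hF : ∀ h b, F (Function.update h p b) = F h) :
    2 * ∑ h : Fin N → Bool, (if h p = true then F h else 0) = ∑ h : Fin N → Bool, F h := by
  have hinv : Function.Involutive fun h : Fin N → Bool => Function.update h p (!h p) :=
    fun h => by simp
  have h1 : ∑ h : Fin N → Bool, (if h p = true then F h else 0) =
      ∑ h : Fin N → Bool, (if h p = true then 0 else F h) := by
    refine Fintype.sum_equiv (hinv.toPerm _) _ _ fun h => ?_
    simp only [Function.Involutive.coe_toPerm, Function.update_self, hF]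
    cases h p <;> simp
  rw [two_mul]
  nth_rw 2 [h1]
  rw [← Finset.sum_add_distrib]
  exact Finset.sum_congr rfl fun h _ => by split_ifs <;> simp

theorem total_field (v : P → V) {j k : ℕ} {p : Fin N} (hp : (p : ℕ) + k + 1 = N) :
    total N v j k - 1 / 3 * total₁ v j k p ≤ total N v j (k + 1) := by
  simp only [total, total₁, Finset.mul_sum, ← Finset.sum_sub_distrib]
  refine Finset.sum_le_sum fun π _ => ?_
  have hF := two_mul_sum_ite_update (p := p)
    (fun h => (3 : ℝ) ^ optimum (v ∘ π) h j k * frz (v ∘ π) h j k p) fun h b => by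
      simp only [optimum, frz, value_update (v ∘ π) h (show (p : ℕ) + k < N by omega)]
  rw [Finset.sum_sub_distrib, ← Finset.mul_sum, ← hF, ← mul_assoc, Finset.mul_sum,
    ← Finset.sum_sub_distrib]
  refine Finset.sum_le_sum fun h _ => ?_
  have := optimum_field (v ∘ π) h j k hp
  split_ifs at * <;> linarith

theorem total_field_le (v : P → V) {j k : ℕ} (hk : k < N) :
    total N v j (k + 1) ≤ total N v j k :=
  Finset.sum_le_sum fun π _ => Finset.sum_le_sum fun h _ =>
    pow_le_pow_right₀ (by norm_num)
      (optimum_field_le (v ∘ π) h j k (p := (⟨N - k - 1, by omega⟩ : Fin N)) (by simp; omega))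

theorem total_field_ge (v : P → V) {j k : ℕ} (hk : k < N) :
    2 / 3 * total N v j k ≤ total N v j (k + 1) := by
  have h1 := total_field v (j := j) (k := k) (p := (⟨N - k - 1, by omega⟩ : Fin N))
    (by simp; omega)
  have h2 := total₁_le v j k (⟨N - k - 1, by omega⟩ : Fin N)
  linarith

theorem total_edge_le (v : P → V) (j k : ℕ) : total N v (j + 1) k ≤ total N v j k :=
  Finset.sum_le_sum fun π _ => Finset.sum_le_sum fun h _ =>
    pow_le_pow_right₀ (by norm_num) (Finset.sup_mono (indepFamily_succ_subset (v ∘ π) j))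

theorem total_pos (hN : Fintype.card P = N) (v : P → V) (j k : ℕ) : 0 < total N v j k := by
  have : Nonempty (Fin N ≃ P) := ⟨(Fintype.equivFinOfCardEq hN).symm⟩
  exact Finset.sum_pos (fun π _ => Finset.sum_pos (fun h _ => by positivity) univ_nonempty)
    univ_nonempty

/-- The interpolation inequality: one edge against two fields. -/
theorem total_edge_mul_le (hN : Fintype.card P = N) (v : P → V) {j k M : ℕ} (hM : 2 ≤ M)
    (hjk : 2 * j + k + M ≤ N) :
    total N v (j + 1) k * total N v j k * (5 / 6) ≤
      total N v j (k + 1) ^ 2 * (1 + 3 / (2 * M)) := by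
  have hT := total_pos hN v j k
  let p : Fin N := ⟨2 * j, by omega⟩
  let q : Fin N := ⟨2 * j + 1, by omega⟩
  let s : Fin N := ⟨N - k - 1, by omega⟩
  have hp : p ∈ freePos N j k := by rw [mem_freePos]; simp [p]; omega
  have hq : q ∈ freePos N j k := by rw [mem_freePos]; simp [q]; omega
  have hs : s ∈ freePos N j k := by rw [mem_freePos]; simp [s]; omega
  have hpq : p ≠ q := by simp [p, q]
  set T := total N v j k
  obtain ⟨r, hr⟩ : ∃ r, total₁ v j k p = r * T := ⟨total₁ v j k p / T, by field_simp⟩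
  have hr0 : 0 ≤ r := by
    have := total₁_nonneg v j k p
    rw [hr] at this
    exact nonneg_of_mul_nonneg_left this hT
  have hr1 : r ≤ 1 := by
    have := total₁_le v j k p
    rw [hr] at this
    exact (mul_le_iff_le_one_left hT).1 this
  have hf := total_field v (j := j) (k := k) (p := s) (by simp [s]; omega)
  rw [total₁_eq v hs hp, hr] at hf
  have he := total_edge v (j := j) (k := k) (p := p) (q := q) rfl rfl
  have h2 := total₂_ge v hp hq hpq r hr
  have hcard : M ≤ #(freePos N j k) := by rw [card_freePos]; omega
  have hMm : (M : ℝ) ≤ #(freePos N j k) := by exact_mod_cast hcard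
  set m : ℝ := (#(freePos N j k) : ℝ)
  have hM2 : (2 : ℝ) ≤ M := by exact_mod_cast hM
  have hm : 2 ≤ m := hM2.trans hMm
  -- Sampling two distinct free positions instead of two independent ones costs at most `1 / M`.
  have h3 : (r ^ 2 - 1 / M) * T ≤ total₂ v j k p q := by
    have h4 : (r ^ 2 * m - r) * T ≤ (m - 1) * total₂ v j k p q := by
      refine le_of_mul_le_mul_left ?_ (show 0 < m by linarith)
      linarith
    have h5 : (m - 1) * (r ^ 2 - 1 / M) ≤ r ^ 2 * m - r := by
      have h6 : 1 / m ≤ 1 / (M : ℝ) := one_div_le_one_div_of_le (by linarith) hMm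
      have h7 : (m - 1) * (1 / m) ≤ (m - 1) * (1 / (M : ℝ)) :=
        mul_le_mul_of_nonneg_left h6 (by linarith)
      have h8 : 1 / 2 ≤ (m - 1) * (1 / m) := by
        rw [mul_one_div, le_div_iff₀ (by linarith)]; linarith
      nlinarith [sq_nonneg (r - 1 / 2)]
    refine le_of_mul_le_mul_left ?_ (show 0 < m - 1 by linarith)
    calc (m - 1) * ((r ^ 2 - 1 / M) * T) = (m - 1) * (r ^ 2 - 1 / M) * T := by ring
      _ ≤ (r ^ 2 * m - r) * T := by gcongr
      _ ≤ _ := h4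
  have h4 : total N v (j + 1) k ≤ T * (1 - 2 / 3 * r ^ 2 + 2 / 3 * (1 / M)) := by
    change _ ≤ T - _ at he
    nlinarith
  have hi : 0 ≤ 1 / (M : ℝ) := by positivity
  calc total N v (j + 1) k * T * (5 / 6)
      ≤ T * (1 - 2 / 3 * r ^ 2 + 2 / 3 * (1 / M)) * T * (5 / 6) := by gcongr
    _ = T ^ 2 * ((1 - 2 / 3 * r ^ 2 + 2 / 3 * (1 / M)) * (5 / 6)) := by ring
    _ ≤ T ^ 2 * ((1 - 1 / 3 * r) ^ 2 * (1 + 3 / (2 * M))) := by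
        refine mul_le_mul_of_nonneg_left ?_ (by positivity)
        have : (3 : ℝ) / (2 * M) = 3 / 2 * (1 / M) := by field_simp
        rw [this]
        have h9 : 4 / 9 ≤ (1 - 1 / 3 * r) ^ 2 := by nlinarith
        -- The main terms differ by exactly `(2/3)(r - 1/2)²`, so 5/6 is sharp at `r = 1/2`; the
        -- error term fits because `5/9 ≤ (3/2)(4/9)`.
        nlinarith [sq_nonneg (r - 1 / 2), mul_nonneg hi (sub_nonneg.2 h9)]
    _ = (T - 1 / 3 * (r * T)) ^ 2 * (1 + 3 / (2 * M)) := by ring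
    _ ≤ _ := by
        gcongr
        nlinarith

end Average
-- Iterating the recursion.
/-- Window averaging turns the one-edge-against-two-fields recursion into a bound that trades
all `J` edges for `2 * J` fields. -/
theorem sum_window_le {g : ℕ → ℕ → ℝ} {N W : ℕ} {b κ : ℝ} (hW : 1 ≤ W)
    (hrec : ∀ j k, 2 * j + k + W ≤ N → g (j + 1) k + g j k + κ ≤ 2 * g j (k + 1))
    (hanti : ∀ j k, k < N → g j (k + 1) ≤ g j k)
    (hlip : ∀ j k, k < N → g j k ≤ g j (k + 1) + b) (J k : ℕ) (hJ : 2 * J + k + 2 * W ≤ N) :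
    ∑ i ∈ range W, g J (k + i) ≤ ∑ i ∈ range W, g 0 (k + 2 * J + i) + J * (b - W * κ) := by
  induction J generalizing k with
  | zero => simp
  | succ J ih =>
    have hstep : ∀ k, ∑ i ∈ range W, g J (k + 1 + i) =
        ∑ i ∈ range W, g J (k + i) + g J (k + W) - g J k := by
      intro k
      have h1 := Finset.sum_range_succ (fun i => g J (k + i)) W
      have h2 := Finset.sum_range_succ' (fun i => g J (k + i)) W
      simp only [add_zero] at h2
      have h3 : ∑ i ∈ range W, g J (k + 1 + i) = ∑ i ∈ range W, g J (k + (i + 1)) :=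
        Finset.sum_congr rfl fun i _ => by congr 1; ring
      linarith
    have h1 : ∑ i ∈ range W, g (J + 1) (k + i) + ∑ i ∈ range W, g J (k + i) + W * κ ≤
        2 * ∑ i ∈ range W, g J (k + 1 + i) := by
      rw [Finset.mul_sum, ← Finset.sum_add_distrib]
      have : (W : ℝ) * κ = ∑ i ∈ range W, κ := by simp
      rw [this, ← Finset.sum_add_distrib]
      refine Finset.sum_le_sum fun i hi => ?_
      rw [mem_range] at hi
      have := hrec J (k + i) (by omega)
      rwa [show k + 1 + i = k + i + 1 by ring]
    -- For window sums `S`, the quantity `2S(k+1) - S(k) - S(k+2)` telescopes to a drop of `g` at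
    -- the right end minus a drop at the left end, hence is at most `b`. No concavity in `k` is
    -- needed.
    have h2 := hstep k
    have h3 := hstep (k + 1)
    have h4 := ih (k + 2) (by omega)
    have h5 := hanti J k (by omega)
    have h6 := hlip J (k + W) (by omega)
    rw [show k + 1 + 1 = k + 2 by ring, show k + 1 + W = k + W + 1 by ring] at h3
    rw [show k + 2 + 2 * J = k + 2 * (J + 1) by ring] at h4
    push_cast
    linarith

theorem iterate_field_le {f : ℕ → ℝ} {N : ℕ} {b : ℝ} (hlip : ∀ k, k < N → f k ≤ f (k + 1) + b)
    (k d : ℕ) (h : k + d ≤ N) : f k ≤ f (k + d) + d * b := by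
  induction d with
  | zero => simp
  | succ d ih =>
    have h1 := ih (by omega)
    have h2 := hlip (k + d) (by omega)
    push_cast
    rw [← add_assoc]
    linarith

/-- The last `W` edges are discarded by monotonicity to keep room for the window. Replacing the
window averages by their end values costs `W * b` on the edge side and `2 * W * b` on the field
side. -/
theorem interpolate_log {g : ℕ → ℕ → ℝ} {m W : ℕ} {b κ : ℝ} (hW : 1 ≤ W) (hm : W ≤ m)
    (hb : 0 ≤ b)
    (hrec : ∀ j k, 2 * j + k + W ≤ 2 * m → g (j + 1) k + g j k + κ ≤ 2 * g j (k + 1))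
    (hanti : ∀ j k, k < 2 * m → g j (k + 1) ≤ g j k)
    (hlip : ∀ j k, k < 2 * m → g j k ≤ g j (k + 1) + b)
    (hedge : ∀ j k, g (j + 1) k ≤ g j k) (hκ : κ ≤ 0) :
    g m 0 ≤ g 0 (2 * m) + 3 * W * b + m * (b / W - κ) := by
  have hw := sum_window_le hW hrec hanti hlip (m - W) 0 (by omega)
  have hmono : g m 0 ≤ g (m - W) 0 := 
    antitone_nat_of_succ_le (f := fun j => g j 0) (fun j => hedge j 0) (Nat.sub_le m W)
  have hWpos : (0 : ℝ) < W := by exact_mod_cast hW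
  have h1 : (W : ℝ) * (g m 0 - W * b) ≤ ∑ i ∈ range W, g (m - W) (0 + i) := by
    have : (W : ℝ) * (g m 0 - W * b) = ∑ i ∈ range W, (g m 0 - W * b) := by
      rw [sum_const, card_range, nsmul_eq_mul]
    rw [this]
    refine Finset.sum_le_sum fun i hi => ?_
    rw [mem_range] at hi
    have h2 := iterate_field_le (hlip (m - W)) 0 i (by omega)
    have h3 : (i : ℝ) * b ≤ W * b := by gcongr
    linarith
  have h2 : ∑ i ∈ range W, g 0 (0 + 2 * (m - W) + i) ≤ W * (g 0 (2 * m) + 2 * W * b) := by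
    have : (W : ℝ) * (g 0 (2 * m) + 2 * W * b) =
      ∑ i ∈ range W, (g 0 (2 * m) + 2 * W * b) := by
      rw [sum_const, card_range, nsmul_eq_mul]
    rw [this]
    refine Finset.sum_le_sum fun i hi => ?_
    rw [mem_range] at hi
    have h2 := iterate_field_le (hlip 0) (0 + 2 * (m - W) + i) (2 * W - i) (by omega)
    rw [show 0 + 2 * (m - W) + i + (2 * W - i) = 2 * m by omega] at h2
    have h3 : ((2 * W - i : ℕ) : ℝ) * b ≤ 2 * W * b := by
      gcongr
      exact_mod_cast Nat.sub_le _ _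
    linarith
  have h3 : ((m - W : ℕ) : ℝ) * (b - W * κ) ≤ m * (b - W * κ) := by
    have : (W : ℝ) * κ ≤ 0 := mul_nonpos_of_nonneg_of_nonpos hWpos.le hκ
    gcongr
    · linarith
    · omega
  have h4 : (m : ℝ) * (b - W * κ) = W * (m * (b / W - κ)) := by field_simp
  have h5 : (W : ℝ) * (g m 0 - W * b) ≤
      W * (g 0 (2 * m) + 2 * W * b + m * (b / W - κ)) := by linarith
  have := le_of_mul_le_mul_left h5 hWpos
  linarith

/-! ### The interpolation bound for the totals. -/

section Totals
variable {V P : Type*} [Fintype V] [DecidableEq V] [Fintype P] [DecidableEq P]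

theorem log_total_le (v : P → V) {m W : ℕ} (hN : Fintype.card P = 2 * m) (hW : 2 ≤ W)
    (hm : W ≤ m) :
    Real.log (total (2 * m) v m 0) ≤
      Real.log (total (2 * m) v 0 (2 * m)) + 3 * W + m * (Real.log (6 / 5) + 2 / W) := by
  have hpos := total_pos hN v
  have hWpos : (2 : ℝ) ≤ W := by exact_mod_cast hW
  have hb : Real.log (3 / 2) ≤ 1 / 2 := by
    have := Real.log_le_sub_one_of_pos (show (0 : ℝ) < 3 / 2 by norm_num)
    linarith
  have hb0 : 0 ≤ Real.log (3 / 2) := Real.log_nonneg (by norm_num)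
  have h65 : Real.log (5 / 6) = - Real.log (6 / 5) := by
    rw [← Real.log_inv]; norm_num
  have h6 : 0 ≤ Real.log (6 / 5) := Real.log_nonneg (by norm_num)
  -- `b` reflects that one field costs a factor of at least 2/3; `κ` is the logarithm of 5/6
  -- together with the finite-sample error.
  have h := interpolate_log (g := fun j k => Real.log (total (2 * m) v j k)) (m := m) (W := W)
    (b := Real.log (3 / 2)) (κ := - Real.log (6 / 5) - 3 / (2 * W)) (by omega) hm hb0 ?_ ?_ ?_ ?_ ?_
  · refine h.trans ?_
    have e1 : 3 * (W : ℝ) * Real.log (3 / 2) ≤ 3 * W := by nlinarith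
    have e2 : Real.log (3 / 2) / W - (-Real.log (6 / 5) - 3 / (2 * W)) ≤
        Real.log (6 / 5) + 2 / W := by
      have : Real.log (3 / 2) / W ≤ (1 / 2) / W := by gcongr
      have e3 : (1 / 2 : ℝ) / W + 3 / (2 * W) = 2 / W := by field_simp; norm_num
      linarith
    gcongr
  · intro j k hjk
    have h1 := total_edge_mul_le hN v hW hjk
    have h2 := Real.log_le_log (by have := hpos (j + 1) k; have := hpos j k; positivity) h1
    have p1 := (hpos (j + 1) k).ne'
    have p2 := (hpos j k).ne'
    have p3 := (hpos j (k + 1)).ne'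
    rw [Real.log_mul (mul_ne_zero p1 p2) (by norm_num), Real.log_mul p1 p2,
      Real.log_mul (pow_ne_zero 2 p3) (by positivity), Real.log_pow, h65] at h2
    have h3 := Real.log_le_sub_one_of_pos (show (0 : ℝ) < 1 + 3 / (2 * W) by positivity)
    push_cast at h2
    linarith
  · intro j k hk
    exact Real.log_le_log (hpos _ _) (total_field_le v hk)
  · intro j k hk
    have h1 := total_field_ge v (j := j) hk
    rw [← Real.log_mul (hpos _ _).ne' (by norm_num)]
    exact Real.log_le_log (hpos _ _) (by linarith)
  · exact fun j k => Real.log_le_log (hpos _ _) (total_edge_le v j k)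
  · have : 0 ≤ 3 / (2 * (W : ℝ)) := by positivity
    linarith

end Totals

/-! ### The system with fields only. -/

section Terminal

/-- Each selected vertex with an active field is charged at least once, which cancels its
contribution to the size. -/
theorem optimum_all_fields_le {V : Type*} [Fintype V] [DecidableEq V] {N : ℕ} (x : Fin N → V)
    (h : Fin N → Bool) (j : ℕ) :
    optimum x h j N ≤ #{u : V | ∀ p, x p = u → h p = false} := by
  refine Finset.sup_le fun S _ => ?_
  have h1 : S ⊆ ({u : V | ∀ p, x p = u → h p = false} : Finset V) ∪
      ({p : Fin N | N ≤ p + N ∧ h p = true ∧ x p ∈ S} : Finset (Fin N)).image x := by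
    intro u hu
    by_cases hc : ∀ p, x p = u → h p = false
    · exact mem_union_left _ (by simpa using hc)
    · push Not at hc
      obtain ⟨p, rfl, hp⟩ := hc
      refine mem_union_right _ (mem_image_of_mem _ ?_)
      simpa [hu] using hp
  have h2 := (Finset.card_le_card h1).trans (Finset.card_union_le _ _)
  have h3 := Finset.card_image_le (s := ({p : Fin N | N ≤ p + N ∧ h p = true ∧ x p ∈ S} :
    Finset (Fin N))) (f := x)
  unfold value penalty
  omega

/-- The sum factorises over vertices; of the 8 patterns on three points, one has weight 3 and seven
have weight 1. -/
theorem sum_three_pow_unwarned (n : ℕ) :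
    ∑ h : Fin n × Fin 3 → Bool,
      (3 : ℝ) ^ #{u : Fin n | ∀ p : Fin n × Fin 3, p.1 = u → h p = false} = 10 ^ n := by
  have h1 : ∀ h : Fin n × Fin 3 → Bool,
      (3 : ℝ) ^ #{u : Fin n | ∀ p : Fin n × Fin 3, p.1 = u → h p = false} =
      ∏ u : Fin n, if Function.curry h u = (fun _ => false) then 3 else 1 := by
    intro h
    rw [Finset.prod_ite]
    simp only [prod_const, one_pow, mul_one]
    congr 2
    refine Finset.filter_congr fun u _ => ?_
    constructor
    · intro hh; funext i; exact hh (u, i) rfl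
    · rintro hh ⟨a, i⟩ rfl; exact congrFun hh i
  simp only [h1]
  refine ((Equiv.curry (Fin n) (Fin 3) Bool).sum_comp
    fun f => ∏ u : Fin n, if f u = (fun _ => false) then (3 : ℝ) else 1).trans ?_
  rw [← Fintype.piFinset_univ, ← Finset.prod_univ_sum (fun _ => univ)
    fun _ (y : Fin 3 → Bool) => if y = (fun _ => false) then (3 : ℝ) else 1]
  have h2 : ∑ y : Fin 3 → Bool, (if y = (fun _ => false) then (3 : ℝ) else 1) = 10 := by
    have : ∀ y : Fin 3 → Bool, (if y = (fun _ => false) then (3 : ℝ) else 1) =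
      1 + if y = (fun _ => false) then 2 else 0 := fun y => by split_ifs <;> norm_num
    simp only [this, Finset.sum_add_distrib, Finset.sum_ite_eq', mem_univ, if_true]
    simp
    norm_num
  simp [h2]

theorem total_all_fields_le (n N : ℕ) (hN : Fintype.card (Points n) = N) :
    total N (Prod.fst : Points n → Fin n) 0 N ≤ N.factorial * 10 ^ n := by
  have h1 : ∀ π : Fin N ≃ Points n,
      ∑ h : Fin N → Bool, (3 : ℝ) ^ optimum (Prod.fst ∘ π) h 0 N ≤ 10 ^ n := by
    intro π
    rw [← sum_three_pow_unwarned n, ← (π.arrowCongr (Equiv.refl Bool)).sum_comp]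
    refine Finset.sum_le_sum fun h _ => pow_le_pow_right₀ (by norm_num) ?_
    refine (optimum_all_fields_le _ h 0).trans (Finset.card_le_card fun u hu => ?_)
    simp only [mem_filter, mem_univ, true_and, Function.comp_apply] at hu ⊢
    intro p hp
    exact hu (π.symm p) (by simpa using hp)
  refine (Finset.sum_le_sum fun π _ => h1 π).trans ?_
  rw [sum_const, card_univ, Fintype.card_equiv (Fintype.equivFinOfCardEq hN).symm, Fintype.card_fin,
    nsmul_eq_mul]

end Terminal

/-! ### Arrangements compatible with a perfect matching. -/

section Arrangements
variable {P : Type*} [Fintype P] [DecidableEq P]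

theorem exists_paired_equiv {m : ℕ} (hP : Fintype.card P = 2 * m) {φ : P → P}
    (hφ : Function.Involutive φ) (hne : ∀ p, φ p ≠ p) :
    ∃ B : Fin m × Fin 2 ≃ P, ∀ a, B (a, 1) = φ (B (a, 0)) := by
  let e := Fintype.equivFin P
  let f : {x : P // e x < e (φ x)} × Fin 2 → P := fun y => if y.2 = 0 then y.1.1 else φ y.1.1
  have hf : Function.Bijective f := by
    constructor
    · rintro ⟨⟨x, hx⟩, a⟩ ⟨⟨y, hy⟩, b⟩ h
      fin_cases a <;> fin_cases b <;> simp [f] at h ⊢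
      · exact h
      · subst h; rw [hφ] at hx; exact absurd (hx.trans hy) (lt_irrefl _)
      · subst h; rw [hφ] at hy; exact absurd (hx.trans hy) (lt_irrefl _)
      · exact hφ.injective h
    · intro p
      rcases lt_trichotomy (e p) (e (φ p)) with h | h | h
      · exact ⟨(⟨p, h⟩, 0), by simp [f]⟩
      · exact absurd (e.injective h).symm (hne p)
      · exact ⟨(⟨φ p, by rwa [hφ]⟩, 1), by simp [f, hφ p]⟩
  have hcard := (Fintype.card_of_bijective hf).trans hP
  rw [Fintype.card_prod, Fintype.card_fin] at hcard
  have hm : Fintype.card {x : P // e x < e (φ x)} = m := by omega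
  refine ⟨(Equiv.prodCongr (Fintype.equivFinOfCardEq hm).symm (Equiv.refl _)).trans
    (Equiv.ofBijective f hf), fun a => ?_⟩
  simp [f]

/-- The arrangements in which the points at positions `2a` and `2a + 1` are partners. -/
def IsPaired {N : ℕ} (φ : P → P) (π : Fin N ≃ P) : Prop :=
  ∀ p q : Fin N, (q : ℕ) = p + 1 → Even (p : ℕ) → π q = φ (π p)

open Classical in
-- From one compatible arrangement, permuting the `m` pairs and flipping inside each gives distinct
-- compatible ones.
theorem card_isPaired_ge {m : ℕ} (hP : Fintype.card P = 2 * m) {φ : P → P}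
    (hφ : Function.Involutive φ) (hne : ∀ p, φ p ≠ p) :
    2 ^ m * m.factorial ≤ #{π : Fin (2 * m) ≃ P | IsPaired φ π} := by
  obtain ⟨B, hB⟩ := exists_paired_equiv hP hφ hne
  let c : Fin (2 * m) ≃ Fin m × Fin 2 :=
    (finCongr (mul_comm 2 m)).trans finProdFinEquiv.symm
  let Φ : (Fin m → Equiv.Perm (Fin 2)) × Equiv.Perm (Fin m) → (Fin (2 * m) ≃ P) :=
    fun y => c.trans ((Equiv.prodShear y.2 y.1).trans B)
  have hinj : Function.Injective Φ := by
    rintro ⟨s, ρ⟩ ⟨s', ρ'⟩ h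
    have h1 : ∀ a b, (ρ a, s a b) = (ρ' a, s' a b) := fun a b => by
      have := congrArg (fun π : Fin (2 * m) ≃ P => π (c.symm (a, b))) h
      simpa [Φ, Equiv.prodShear] using this
    have h2 : s = s' := by
      funext a; ext b; exact congrArg Fin.val (congrArg Prod.snd (h1 a b))
    have h3 : ρ = ρ' := by
      ext a; exact congrArg Fin.val (congrArg Prod.fst (h1 a 0))
    rw [h2, h3]
  have hcard : Fintype.card ((Fin m → Equiv.Perm (Fin 2)) × Equiv.Perm (Fin m)) =
      2 ^ m * m.factorial := by
    simp [Fintype.card_perm]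
  rw [← hcard, ← Finset.card_univ]
  refine Finset.card_le_card_of_injOn Φ ?_ hinj.injOn
  rintro ⟨s, ρ⟩ -
  simp only [coe_filter, mem_univ, true_and, Set.mem_ofPred_eq]
  intro p q hpq hp
  obtain ⟨a, ha⟩ := hp
  have ham : a < m := by omega
  have hcp : c p = (⟨a, ham⟩, 0) := by
    rw [← Equiv.eq_symm_apply]
    ext
    simp [c, finProdFinEquiv]
    omega
  have hcq : c q = (⟨a, ham⟩, 1) := by
    rw [← Equiv.eq_symm_apply]
    ext
    simp [c, finProdFinEquiv]
    omega
  have hBB : ∀ (d : Fin m) (u w : Fin 2), u ≠ w → B (d, u) = φ (B (d, w)) := by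
    intro d u w huw
    fin_cases u <;> fin_cases w <;> simp [hB, hφ (B (d, 0))] at huw ⊢
  simp only [Φ, Equiv.trans_apply, hcp, hcq, Equiv.prodShear_apply]
  exact hBB _ _ _ fun h => by simpa using (s ⟨a, ham⟩).injective h

end Arrangements

/-! ### From arrangements to pairings. -/

section Pairings
variable {n : ℕ}

/-- The partner of a point in a pairing. -/
noncomputable def Pairing.partner (F : Pairing n) (p : Points n) : Points n :=
  (SimpleGraph.Subgraph.isPerfectMatching_iff.1 F.2 p).choose

theorem Pairing.adj_iff (F : Pairing n) (p q : Points n) : F.1.Adj p q ↔ q = F.partner p := by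
  have h := (SimpleGraph.Subgraph.isPerfectMatching_iff.1 F.2 p).choose_spec
  exact ⟨fun hq => h.2 q hq, fun hq => hq ▸ h.1⟩

theorem Pairing.partner_involutive (F : Pairing n) : Function.Involutive F.partner := fun p =>
  ((F.adj_iff _ _).1 ((F.adj_iff p _).2 rfl).symm).symm

theorem Pairing.partner_ne (F : Pairing n) (p : Points n) : F.partner p ≠ p :=
  ((F.adj_iff p _).2 rfl).ne.symm

theorem Pairing.partner_injective : Function.Injective (Pairing.partner (n := n)) := by
  intro F G h
  refine Subtype.ext (SimpleGraph.Subgraph.ext ?_ ?_)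
  · rw [SimpleGraph.Subgraph.isSpanning_iff.1 F.2.2, SimpleGraph.Subgraph.isSpanning_iff.1 G.2.2]
  · ext p q
    rw [F.adj_iff, G.adj_iff, h]

theorem Pairing.eq_of_isPaired {m : ℕ} {F G : Pairing n} {π : Fin (2 * m) ≃ Points n}
    (hF : IsPaired F.partner π) (hG : IsPaired G.partner π) : F = G := by
  have key : ∀ r : Fin (2 * m), F.partner (π r) = G.partner (π r) := by
    intro r
    rcases Nat.even_or_odd (r : ℕ) with hr | hr
    · have hlt : (r : ℕ) + 1 < 2 * m := by
        obtain ⟨a, ha⟩ := hr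
        omega
      rw [← hF r ⟨r + 1, hlt⟩ rfl hr, ← hG r ⟨r + 1, hlt⟩ rfl hr]
    · obtain ⟨a, ha⟩ := hr
      let p : Fin (2 * m) := ⟨2 * a, by omega⟩
      have h1 := hF p r ha (even_two_mul a)
      have h2 := hG p r ha (even_two_mul a)
      rw [congrArg F.partner h1, congrArg G.partner h2, F.partner_involutive,
        G.partner_involutive]
  refine Pairing.partner_injective (funext fun p => ?_)
  simpa using key (π.symm p)

theorem Pairing.indepNum_le_optimum {m : ℕ} {F : Pairing n} (hF : F.proj.Simple)
    {π : Fin (2 * m) ≃ Points n} (hπ : IsPaired F.partner π) (h : Fin (2 * m) → Bool) :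
    F.indepNum ≤ optimum (Prod.fst ∘ π) h m 0 := by
  obtain ⟨S, hS⟩ := F.graph.exists_isNIndepSet_indepNum
  have hmem : S ∈ indepFamily (Prod.fst ∘ π) m := by
    rw [mem_indepFamily]
    rintro p q hpq hp - ⟨h1, h2⟩
    have hadj : F.proj.Adj (π p).1 (π q).1 := by
      refine Graph.Adj.map Prod.fst ?_
      rw [Graph.ofSimpleGraph_adj_iff, SimpleGraph.Subgraph.spanningCoe_adj, F.adj_iff]
      exact hπ p q hpq hp
    -- Simplicity enters here: a loop would be invisible to `F.graph` but would constrain `S`.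
    have hne : (π p).1 ≠ (π q).1 := hadj.ne
    exact hS.isIndepSet h1 h2 hne ⟨hne, hadj⟩
  refine le_trans ?_ (Finset.le_sup (f := value (Prod.fst ∘ π) h 0) hmem)
  have hpen : penalty (Prod.fst ∘ π) h 0 S = 0 := by
    unfold penalty
    rw [Finset.card_eq_zero, Finset.filter_eq_empty_iff]
    rintro p - ⟨hp, -⟩
    have := p.2
    omega
  rw [value, hpen, hS.card_eq]
  exact le_rfl

open Classical in
/-- Every bad pairing contributes through all of its arrangements. -/
theorem ncard_mul_le_total {m : ℕ} (hP : Fintype.card (Points n) = 2 * m)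
    (A : Set (Pairing n)) (t : ℝ) (hA : ∀ F ∈ A, F.proj.Simple ∧ t ≤ F.indepNum) :
    (A.ncard : ℝ) * (2 ^ m * m.factorial) * (2 ^ (2 * m) * 3 ^ t) ≤
      total (2 * m) (Prod.fst : Points n → Fin n) m 0 := by
  have hfin : A.Finite := Set.toFinite A
  let D : Finset (Fin (2 * m) ≃ Points n) :=
    hfin.toFinset.biUnion fun F => {π | IsPaired F.partner π}
  have hD : A.ncard * (2 ^ m * m.factorial) ≤ #D := by
    rw [Finset.card_biUnion, Set.ncard_eq_toFinset_card A hfin]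
    · rw [← smul_eq_mul]
      exact Finset.card_nsmul_le_sum _ _ _ fun F _ =>
        card_isPaired_ge hP F.partner_involutive F.partner_ne
    · intro F _ G _ hFG
      rw [Function.onFun, Finset.disjoint_left]
      intro π h1 h2
      simp only [mem_filter, mem_univ, true_and] at h1 h2
      exact hFG (Pairing.eq_of_isPaired h1 h2)
  have hsum : ∀ π ∈ D, (2 ^ (2 * m) * 3 ^ t : ℝ) ≤
      ∑ h : Fin (2 * m) → Bool, (3 : ℝ) ^ optimum (Prod.fst ∘ π) h m 0 := by
    intro π hπ
    simp only [D, mem_biUnion, mem_filter, mem_univ, true_and, Set.Finite.mem_toFinset] at hπ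
    obtain ⟨F, hF, hπ⟩ := hπ
    have : (2 ^ (2 * m) * 3 ^ t : ℝ) = ∑ h : Fin (2 * m) → Bool, (3 : ℝ) ^ t := by
      simp
    rw [this]
    refine Finset.sum_le_sum fun h _ => ?_
    rw [← Real.rpow_natCast]
    refine Real.rpow_le_rpow_of_exponent_le (by norm_num) ((hA F hF).2.trans ?_)
    exact_mod_cast Pairing.indepNum_le_optimum (hA F hF).1 hπ h
  calc (A.ncard : ℝ) * (2 ^ m * m.factorial) * (2 ^ (2 * m) * 3 ^ t)
      ≤ #D * (2 ^ (2 * m) * 3 ^ t) := by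
        gcongr
        exact_mod_cast hD
    _ = ∑ π ∈ D, (2 ^ (2 * m) * 3 ^ t : ℝ) := by simp
    _ ≤ ∑ π ∈ D, ∑ h : Fin (2 * m) → Bool, (3 : ℝ) ^ optimum (Prod.fst ∘ π) h m 0 :=
        Finset.sum_le_sum hsum
    _ ≤ _ := Finset.sum_le_sum_of_subset_of_nonneg (Finset.subset_univ D)
        fun _ _ _ => Finset.sum_nonneg fun _ _ => by positivity

end Pairings
-- Numerics and conclusion.
/-- The exponential rate at which pairings with independence ratio above `0.454` disappear. -/
noncomputable def decayRate : ℝ :=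
  0.454 * Real.log 3 - Real.log (5 / 4) - 3 / 2 * Real.log (6 / 5) - 1 / 1000

set_option exponentiation.threshold 1000 in
theorem decayRate_pos : 0 < decayRate := by
  have h1 : (1 : ℝ) / 1000 ≤ Real.log (1000 / 999) := by
    have := Real.one_sub_inv_le_log_of_pos (show (0 : ℝ) < 1000 / 999 by norm_num)
    norm_num at this ⊢
    linarith
  -- Multiplying the rate by 500 makes all exponents integers (`0.454 * 500 = 227`); 1000/999
  -- absorbs the slack of 1/1000.
  have h2 : Real.log ((5 / 4) ^ 500 * (6 / 5) ^ 750 * (1000 / 999) ^ 500) < Real.log (3 ^ 227) :=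
    Real.log_lt_log (by positivity) (by norm_num)
  rw [Real.log_mul (by positivity) (by positivity), Real.log_mul (by positivity) (by positivity),
    Real.log_pow, Real.log_pow, Real.log_pow, Real.log_pow] at h2
  push_cast at h2
  unfold decayRate
  linarith

theorem ncard_le_exp_mul {l : ℕ} (hl : 1000 ≤ l) (A : Set (Pairing (2 * l)))
    (hA : ∀ F ∈ A, F.proj.Simple ∧ (0.454 : ℝ) * ((2 * l : ℕ) : ℝ) ≤ F.indepNum) :
    (A.ncard : ℝ) ≤ Real.exp (9000 - decayRate * ((2 * l : ℕ) : ℝ)) *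
      ((Nat.doubleFactorial (3 * (2 * l) - 1) : ℕ) : ℝ) := by
  have hP : Fintype.card (Points (2 * l)) = 2 * (3 * l) := by simp; ring
  have hlow := ncard_mul_le_total hP A _ hA
  -- Window 3000: the boundary term is `3 * 3000 = 9000`, and the loss `2/3000` per edge over `3n/2`
  -- edges is the `1/1000` in `decayRate`.
  have hup := log_total_le (Prod.fst : Points (2 * l) → Fin (2 * l)) hP
    (show 2 ≤ 3000 by norm_num) (by omega)
  have hend := total_all_fields_le (2 * l) (2 * (3 * l)) hP
  have hpos := total_pos hP (Prod.fst : Points (2 * l) → Fin (2 * l))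
  have hfact : ((2 * (3 * l)).factorial : ℝ) =
      2 ^ (3 * l) * (3 * l).factorial * (Nat.doubleFactorial (3 * (2 * l) - 1) : ℕ) := by
    have h := Nat.factorial_eq_mul_doubleFactorial (2 * (3 * l) - 1)
    rw [show 2 * (3 * l) - 1 + 1 = 2 * (3 * l) by omega, Nat.doubleFactorial_two_mul] at h
    rw [h, show 2 * (3 * l) - 1 = 3 * (2 * l) - 1 by omega]
    push_cast
    ring
  set B : ℝ := ((Nat.doubleFactorial (3 * (2 * l) - 1) : ℕ) : ℝ)
  set c : ℝ := 2 ^ (3 * l) * (3 * l).factorial with hc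
  have hcpos : 0 < c := by positivity
  set X : ℝ := 3 * (3000 : ℕ) + ((3 * l : ℕ) : ℝ) * (Real.log (6 / 5) + 2 / (3000 : ℕ)) with hX
  have htot : total (2 * (3 * l)) (Prod.fst : Points (2 * l) → Fin (2 * l)) (3 * l) 0 ≤
      c * B * 10 ^ (2 * l) * Real.exp X := by
    rw [← Real.exp_log (hpos (3 * l) 0)]
    refine (Real.exp_le_exp.2 (hup.trans_eq (add_assoc _ _ _))).trans ?_
    rw [Real.exp_add, Real.exp_log (hpos _ _), ← hfact]
    gcongr
  have h1 : (A.ncard : ℝ) * (2 ^ (2 * (3 * l)) * 3 ^ ((0.454 : ℝ) * ((2 * l : ℕ) : ℝ))) ≤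
      B * 10 ^ (2 * l) * Real.exp X := by
    refine le_of_mul_le_mul_left ?_ hcpos
    calc _ = _ := by ring
      _ ≤ _ := hlow.trans htot
      _ = _ := by ring
  have h2 : (10 : ℝ) ^ (2 * l) * Real.exp X =
      Real.exp (9000 - decayRate * ((2 * l : ℕ) : ℝ)) *
        (2 ^ (2 * (3 * l)) * 3 ^ ((0.454 : ℝ) * ((2 * l : ℕ) : ℝ))) := by
    have e10 : (10 : ℝ) ^ (2 * l) =
        2 ^ (2 * (3 * l)) * Real.exp (((2 * l : ℕ) : ℝ) * Real.log (5 / 4)) := by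
      rw [Real.exp_nat_mul, Real.exp_log (by norm_num),
        show 2 * (3 * l) = 3 * (2 * l) by ring, pow_mul (2 : ℝ) 3, ← mul_pow]
      norm_num
    rw [e10, Real.rpow_def_of_pos (by norm_num), mul_assoc, ← Real.exp_add,
      mul_left_comm (Real.exp (9000 - _)),
      ← Real.exp_add]
    congr 2
    rw [hX, decayRate]
    push_cast
    ring
  refine le_of_mul_le_mul_right ?_
    (show 0 < 2 ^ (2 * (3 * l)) * (3 : ℝ) ^ ((0.454 : ℝ) * ((2 * l : ℕ) : ℝ)) by positivity)
  refine h1.trans_eq ?_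
  rw [mul_assoc, h2]
  ring

end ConfigModel

theorem theorem4 (ε : ℝ) (hε : 0 < ε) :
    ∃ N : ℕ, 0 < N ∧ ∀ n : ℕ, N < n → Even n →
      ({F ∈ ConfigModel.girthPairings 16 n | (0.454 : ℝ) * (n : ℝ) < (F.indepNum : ℝ)}.ncard : ℝ)
        < ε * ((Nat.doubleFactorial (3 * n - 1) : ℕ) : ℝ) := by
  obtain ⟨N, hN⟩ := exists_nat_gt ((9000 - Real.log ε) / ConfigModel.decayRate)
  -- `2000` gives `l ≥ 1000`, so the window fits into the `3 * l` edges; `N` pushes the exponent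
  -- below `log ε`.
  refine ⟨N + 2000, by omega, fun n hn hev => ?_⟩
  obtain ⟨l, rfl⟩ := hev.two_dvd
  refine (ConfigModel.ncard_le_exp_mul (by omega) _ fun F hF => ⟨hF.1.1, hF.2.le⟩).trans_lt ?_
  refine mul_lt_mul_of_pos_right ?_ (by exact_mod_cast Nat.doubleFactorial_pos _)
  rw [← Real.lt_log_iff_exp_lt hε]
  rw [div_lt_iff₀ ConfigModel.decayRate_pos] at hN
  have h1 : (N : ℝ) ≤ ((2 * l : ℕ) : ℝ) := by exact_mod_cast (by omega : N ≤ 2 * l)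
  nlinarith [ConfigModel.decayRate_pos]
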